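/- Let $\mathcal T$ be a theory over a binary signature (unary and binary predicates, and constants), that is, a finite set of single-head rules, each of which is either a plain datalog rule $\Psi(\bar x)\Rightarrow R(\bar y)$ with $\bar y\subseteq\bar x$, or an existential TGD $\Psi(\bar x)\Rightarrow\exists z\,R(z,\bar y)$ with $\bar y\subseteq\bar x$ and $z$ occurring at one (arbitrary) argument position of the head; here $\Psi$ is a conjunction of atoms, and constants may occur in rules. Suppose that $\mathcal T$ is BDD: for every conjunctive query $\Phi(\bar x)$ there is a finite union $\Phi'(\bar x)$ of conjunctive queries (equality atoms are allowed) such that for every finite database instance $D$ (a finite set of facts over an infinite supply of constants) and every tuple $\bar a$ of constants, $\Phi(\bar a)$ is true in all (finite or infinite) structures that contain $D$ and satisfy $\mathcal T$ if and only if $D\models\Phi'(\bar a)$. Suppose further that $\mathcal T$ contains a rule of the form $$Q(\bar x,y)\Rightarrow\exists z\,F(y,z),$$ where $Q$ is a conjunctive query and the binary predicate $F$ does not occur anywhere else in $\mathcal T$. Let $\mathrm{Chase}(D,\mathcal T)=\bigcup_i \mathrm{Chase}^i(D,\mathcal T)$ be the result of the non-oblivious chase: $\mathrm{Chase}^0(D,\mathcal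 T)=D$, and $\mathrm{Chase}^{i+1}(D,\mathcal T)$ arises from $\mathrm{Chase}^i(D,\mathcal T)$ by simultaneously adding, for each rule $t\in\mathcal T$ and each tuple $\bar x$ that satisfies the body of $t$ but for which the head of $t$ is not satisfied in $\mathrm{Chase}^i(D,\mathcal T)$, the head atom of $t$, with a new element $c_{t,\bar x}$ as the value of the existential variable if $t$ is existential. Then for every finite database instance $D$ such that no atom of $F$ occurs in $\mathrm{Chase}(D,\mathcal T)$ there is a finite structure $\mathcal M$ (a finite set of facts) with $D\subseteq\mathcal M$ and $\mathcal M\models\mathcal T$ in which no atom of $F$ occurs. -/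

import Mathlib

/-!
Binary signatures: a type `U` of unary and a type `B` of binary predicate symbols, together with a
type `C` of constants.  Database instances are sets of ground atoms (facts) over `C`.
-/

universe u v w

/-- Atoms over a binary signature with arguments in `α`. -/
inductive BAtom (U : Type u) (B : Type v) (α : Type w) where
  | un (P : U) (a : α) : BAtom U B α
  | bin (R : B) (a b : α) : BAtom U B α

/-- The arguments of an atom. -/
def BAtom.args {U : Type u} {B : Type v} {α : Type w} : BAtom U B α → List α
  | .un _ a => [a]
  | .bin _ a b => [a, b]

/-- Replace the arguments of an atom along `f`. -/
def BAtom.map {U : Type u} {B : Type v} {α : Type*} {β : Type*} (f : α → β) :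
    BAtom U B α → BAtom U B β
  | .un P a => .un P (f a)
  | .bin R a b => .bin R (f a) (f b)

/-- The binary predicate `F` is the predicate of the atom. -/
def BAtom.HasPred {U : Type u} {B : Type v} {α : Type w} (F : B) : BAtom U B α → Prop
  | .un _ _ => False
  | .bin R _ _ => R = F

/-- Terms: variables (numbered by `ℕ`) and constants. -/
inductive FTerm (C : Type w) where
  | var (x : ℕ) : FTerm C
  | const (c : C) : FTerm C

/-- Value of a term, where `ι` interprets the constants and `s` the variables. -/
def FTerm.eval {C : Type w} {α : Type*} (ι : C → α) (s : ℕ → α) : FTerm C → α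
  | .var x => s x
  | .const c => ι c

/-- The set of variables occurring in a list (conjunction) of atoms. -/
def varsOf {U : Type u} {B : Type v} {C : Type w} (l : List (BAtom U B (FTerm C))) : Set ℕ :=
  {x | ∃ A ∈ l, FTerm.var x ∈ A.args}

/-- All the atoms of the conjunction `l` are true in `I` under the assignment `s`. -/
def ConjHolds {U : Type u} {B : Type v} {C : Type w} {α : Type*} (ι : C → α)
    (I : Set (BAtom U B α)) (l : List (BAtom U B (FTerm C))) (s : ℕ → α) : Prop :=
  ∀ A ∈ l, A.map (FTerm.eval ι s) ∈ I

/-! ### Conjunctive queries -/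

/-- A conjunctive query with `k` free positions.  The variables not in `ans` are existentially
quantified; repeated variables or constants in `ans` play the role of equality atoms between
free variables, or between a free variable and a constant.  Boolean queries are the case `k = 0`. -/
structure ConjQuery (U : Type u) (B : Type v) (C : Type w) (k : ℕ) where
  ans : Fin k → FTerm C
  body : List (BAtom U B (FTerm C))

/-- The query is true in `I` for the tuple `a`. -/
def ConjQuery.Holds {U : Type u} {B : Type v} {C : Type w} {k : ℕ} {α : Type*} (ι : C → α)
    (I : Set (BAtom U B α)) (q : ConjQuery U B C k) (a : Fin k → α) : Prop :=
  ∃ s : ℕ → α, ConjHolds ι I q.body s ∧ ∀ i, (q.ans i).eval ι s = a i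

/-! ### Rules and theories -/

/-- All variables of the term are in `V`. -/
def FTerm.VarIn {C : Type w} (V : Set ℕ) (t : FTerm C) : Prop :=
  ∀ x, t = .var x → x ∈ V

/-- The term is a variable outside `V`. -/
def FTerm.NewVar {C : Type w} (V : Set ℕ) (t : FTerm C) : Prop :=
  ∃ x, t = .var x ∧ x ∉ V

/-- Head of a datalog rule whose body has the variables `V`. -/
def IsDatalogHead {U : Type u} {B : Type v} {C : Type w} (V : Set ℕ)
    (A : BAtom U B (FTerm C)) : Prop :=
  ∀ t ∈ A.args, t.VarIn V

/-- Head of an existential TGD whose body has the variables `V`: exactly one argument is the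
existentially quantified variable, the remaining one (if any) comes from the body. -/
def IsExistentialHead {U : Type u} {B : Type v} {C : Type w} (V : Set ℕ) :
    BAtom U B (FTerm C) → Prop
  | .un _ t => t.NewVar V
  | .bin _ t t' => (t.NewVar V ∧ t'.VarIn V) ∨ (t.VarIn V ∧ t'.NewVar V)

/-- A single-head rule: a plain datalog rule or an existential TGD.  The variables of the body are
universally quantified, a variable of the head not in the body is existentially quantified. -/
structure TGDRule (U : Type u) (B : Type v) (C : Type w) where
  body : List (BAtom U B (FTerm C))
  head : BAtom U B (FTerm C)
  wf : IsDatalogHead (varsOf body) head ∨ IsExistentialHead (varsOf body) head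

/-- `I` contains the head of the rule, for some choice of the existential variable (if there is
one), under the assignment `s` of the body variables. -/
def TGDRule.HeadHolds {U : Type u} {B : Type v} {C : Type w} {α : Type*} (ι : C → α)
    (I : Set (BAtom U B α)) (ρ : TGDRule U B C) (s : ℕ → α) : Prop :=
  ∃ s' : ℕ → α, (∀ x ∈ varsOf ρ.body, s' x = s x) ∧ ρ.head.map (FTerm.eval ι s') ∈ I

/-- The binary predicate `F` occurs in the rule. -/
def TGDRule.Mentions {U : Type u} {B : Type v} {C : Type w} (F : B) (ρ : TGDRule U B C) : Prop :=
  ρ.head.HasPred F ∨ ∃ A ∈ ρ.body, A.HasPred F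

/-- A theory is a finite set of rules. -/
structure TGDTheory (U : Type u) (B : Type v) (C : Type w) where
  rules : Set (TGDRule U B C)
  finite : rules.Finite

/-- All rules of `T` are true in the structure `I`. -/
def TGDTheory.Satisfied {U : Type u} {B : Type v} {C : Type w} {α : Type*} (ι : C → α)
    (I : Set (BAtom U B α)) (T : TGDTheory U B C) : Prop :=
  ∀ ρ ∈ T.rules, ∀ s : ℕ → α, ConjHolds ι I ρ.body s → ρ.HeadHolds ι I s

/-- `T, D ⊨ q(a)`: the query is true for `a` in every (finite or infinite) structure that contains
`D` and satisfies `T`.  The structures live on arbitrary domains containing the constants. -/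
def Certain {U : Type u} {B : Type v} {C : Type w} {k : ℕ} (T : TGDTheory U B C)
    (D : Set (BAtom U B C)) (q : ConjQuery U B C k) (a : Fin k → C) : Prop :=
  ∀ (α : Type (max u v w)) (ι : C → α) (I : Set (BAtom U B α)), Function.Injective ι →
    (∀ A ∈ D, A.map ι ∈ I) → T.Satisfied ι I → q.Holds ι I (fun i => ι (a i))

/-- `T` is BDD: every conjunctive query `q` has a positive first order rewriting, that is a (finite)
union `q'` of conjunctive queries such that, over each database instance `D`, the certain answers
to `q` in presence of `T` are exactly the answers to `q'` over `D`. -/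
def TGDTheory.IsBDD {U : Type u} {B : Type v} {C : Type w} (T : TGDTheory U B C) : Prop :=
  ∀ (k : ℕ) (q : ConjQuery U B C k), ∃ q' : List (ConjQuery U B C k),
    ∀ D : Set (BAtom U B C), D.Finite → ∀ a : Fin k → C,
      Certain T D q a ↔ ∃ p ∈ q', p.Holds id D a

/-! ### The (non-oblivious) chase -/

/-- Elements of the chase: the constants, and the new elements `c_{ρ,x}`, one for each rule `ρ` and
each tuple `x` of elements assigned to the body variables of `ρ`. -/
inductive ChaseElem (U : Type u) (B : Type v) (C : Type w) where
  | const (c : C) : ChaseElem U B C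
  | null (ρ : TGDRule U B C) (x : {n : ℕ // n ∈ varsOf ρ.body} → ChaseElem U B C) :
      ChaseElem U B C

open Classical in
/-- Extend an assignment of the body variables of `ρ` by the new element named after it. -/
noncomputable def TGDRule.extend {U : Type u} {B : Type v} {C : Type w} (ρ : TGDRule U B C)
    (s : ℕ → ChaseElem U B C) : ℕ → ChaseElem U B C :=
  fun x => if x ∈ varsOf ρ.body then s x else .null ρ (fun y => s y.1)

/-- One parallel step of the chase: each rule is applied to each tuple satisfying its body for which
the head is not yet satisfied. -/
def chaseStep {U : Type u} {B : Type v} {C : Type w} (T : TGDTheory U B C)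
    (I : Set (BAtom U B (ChaseElem U B C))) : Set (BAtom U B (ChaseElem U B C)) :=
  I ∪ {A | ∃ ρ ∈ T.rules, ∃ s : ℕ → ChaseElem U B C, ConjHolds .const I ρ.body s ∧
    ¬ ρ.HeadHolds .const I s ∧ A = ρ.head.map (FTerm.eval .const (ρ.extend s))}

/-- The union of all finite stages of the chase started from `D`. -/
def chase {U : Type u} {B : Type v} {C : Type w} (T : TGDTheory U B C)
    (D : Set (BAtom U B C)) : Set (BAtom U B (ChaseElem U B C)) :=
  ⋃ i : ℕ, (chaseStep T)^[i] (BAtom.map .const '' D)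

/-- `T` contains a rule `Q(x̄,y) ⇒ ∃ z, F(y,z)`, and `F` occurs nowhere else in `T`. -/
def TGDTheory.HasGoalRule {U : Type u} {B : Type v} {C : Type w} (T : TGDTheory U B C)
    (F : B) : Prop :=
  ∃ ρ ∈ T.rules,
    (∃ y ∈ varsOf ρ.body, ∃ z, z ∉ varsOf ρ.body ∧ ρ.head = .bin F (.var y) (.var z)) ∧
    (∀ A ∈ ρ.body, ¬ A.HasPred F) ∧
    ∀ σ ∈ T.rules, σ ≠ ρ → ¬ σ.Mentions F

/-! An existential head has at most one frontier term, so in the semi-oblivious chase the facts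
created by existential rules form trees hanging off a finite set `K` of named constants. These facts
and `D` make up the skeleton; the rest of that chase is datalog consequence.

Identifying elements of the skeleton that are bisimilar to depth `N`, for finitely many labels,
yields a finite `M`, whose closure under datalog rules is the desired model. The danger is that the
closure triggers an existential rule whose witness is missing. BDD rules this out: such a match is a
certain answer over `M`, so a disjunct of the rewriting, fixed before `N`, holds in `M` itself. For
large `N` this match lifts to the skeleton, at an element with the same label
(`ExistentialRules.eventually_lift`). Soundness of the rewriting (`holds_of_rewriting_holds`) shows
that the rule fires there; labels record which rules fire, so the witness is already present in `M`.

Cycles of a query survive the lifting because the labels contain a colouring that separates elements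
at small distance (`Forest.eq_of_color_eq`). Finally, `F` heads no datalog rule, so an `F`-fact
would come from the skeleton, which maps homomorphically into the chase
(`ExistentialRules.exists_hom`). -/

/-! ### Atoms and terms -/

section Atoms

variable {U : Type u} {B : Type v}

theorem BAtom.map_map {α β γ : Type*} (f : α → β) (g : β → γ) (A : BAtom U B α) :
    (A.map f).map g = A.map (fun x => g (f x)) := by
  cases A <;> rfl

theorem BAtom.map_congr {α β : Type*} {f g : α → β} {A : BAtom U B α}
    (h : ∀ a ∈ A.args, f a = g a) : A.map f = A.map g := by
  cases A <;> simp_all [BAtom.map, BAtom.args]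

theorem BAtom.map_eq_self {α : Type*} {f : α → α} {A : BAtom U B α}
    (h : ∀ a ∈ A.args, f a = a) : A.map f = A := by
  cases A <;> simp_all [BAtom.map, BAtom.args]

theorem BAtom.mem_args_map {α β : Type*} {f : α → β} {A : BAtom U B α} {b : β} :
    b ∈ (A.map f).args ↔ ∃ a ∈ A.args, f a = b := by
  cases A <;> simp [BAtom.map, BAtom.args, eq_comm]

theorem BAtom.hasPred_map {α β : Type*} {f : α → β} {A : BAtom U B α} {F : B} :
    (A.map f).HasPred F ↔ A.HasPred F := by
  cases A <;> rfl

theorem BAtom.finite_setOf_map {α β : Type*} (A : BAtom U B α) {Y : Set β} (hY : Y.Finite) :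
    {X | ∃ f : α → β, X = A.map f ∧ ∀ b ∈ X.args, b ∈ Y}.Finite := by
  cases A with
  | un P a =>
    refine (hY.image (fun y => BAtom.un P y)).subset ?_
    rintro X ⟨f, rfl, h⟩
    exact ⟨f a, h _ (by simp [BAtom.map, BAtom.args]), rfl⟩
  | bin R a b =>
    refine (Set.Finite.image2 (fun y z => BAtom.bin R y z) hY hY).subset ?_
    rintro X ⟨f, rfl, h⟩
    exact ⟨f a, h _ (by simp [BAtom.map, BAtom.args]), f b,
      h _ (by simp [BAtom.map, BAtom.args]), rfl⟩

theorem BAtom.finite_args {α : Type*} (A : BAtom U B α) : {a | a ∈ A.args}.Finite :=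
  A.args.finite_toSet

theorem BAtom.finite_args_of_finite {α : Type*} {I : Set (BAtom U B α)} (h : I.Finite) :
    {a | ∃ A ∈ I, a ∈ A.args}.Finite := by
  refine (h.biUnion fun A _ => A.finite_args).subset ?_
  rintro a ⟨A, hA, ha⟩
  exact Set.mem_biUnion hA ha

theorem FTerm.apply_eval {C : Type w} {α β : Type*} (φ : α → β) (ι : C → α) (s : ℕ → α)
    (t : FTerm C) : φ (t.eval ι s) = t.eval (fun c => φ (ι c)) (fun x => φ (s x)) := by
  cases t <;> rfl

theorem FTerm.eval_congr_ι {C : Type w} {α : Type*} {ι κ : C → α} {s : ℕ → α} {t : FTerm C}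
    (h : ∀ c, t = .const c → ι c = κ c) : t.eval ι s = t.eval κ s := by
  cases t with
  | var x => rfl
  | const c => exact h c rfl

theorem FTerm.VarIn.eval_congr {C : Type w} {α : Type*} {V : Set ℕ} {t : FTerm C}
    (ht : t.VarIn V) {ι : C → α} {s s' : ℕ → α} (h : ∀ x ∈ V, s' x = s x) :
    t.eval ι s' = t.eval ι s := by
  cases t with
  | var x => exact h x (ht x rfl)
  | const c => rfl

/-- The constants occurring in an atom. -/
def BAtom.consts {C : Type w} (A : BAtom U B (FTerm C)) : Set C := {c | FTerm.const c ∈ A.args}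

theorem BAtom.finite_consts {C : Type w} (A : BAtom U B (FTerm C)) : A.consts.Finite :=
  A.finite_args.preimage (fun _ _ _ _ h => FTerm.const.inj h)

/-- The constants occurring in a conjunction. -/
def constsOf {C : Type w} (l : List (BAtom U B (FTerm C))) : Set C := {c | ∃ A ∈ l, c ∈ A.consts}

theorem finite_constsOf {C : Type w} (l : List (BAtom U B (FTerm C))) : (constsOf l).Finite := by
  refine (l.finite_toSet.biUnion fun A _ => A.finite_consts).subset ?_
  rintro c ⟨A, hA, hc⟩
  exact Set.mem_biUnion hA hc

/-- The constants occurring in a theory. -/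
def TGDTheory.consts {C : Type w} (T : TGDTheory U B C) : Set C :=
  {c | ∃ ρ ∈ T.rules, c ∈ constsOf (ρ.head :: ρ.body)}

theorem TGDTheory.finite_consts {C : Type w} (T : TGDTheory U B C) : T.consts.Finite := by
  refine (T.finite.biUnion fun ρ _ => finite_constsOf (ρ.head :: ρ.body)).subset ?_
  rintro c ⟨ρ, hρ, hc⟩
  exact Set.mem_biUnion hρ hc

/-- The constants occurring in a conjunctive query. -/
def ConjQuery.consts {C : Type w} {k : ℕ} (q : ConjQuery U B C k) : Set C :=
  constsOf q.body ∪ {c | ∃ i, q.ans i = .const c}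

theorem ConjQuery.finite_consts {C : Type w} {k : ℕ} (q : ConjQuery U B C k) :
    q.consts.Finite := by
  refine (finite_constsOf _).union ?_
  have : {c | ∃ i, q.ans i = .const c} = FTerm.const ⁻¹' Set.range q.ans := by
    ext c; simp
  rw [this]
  exact (Set.finite_range _).preimage (fun _ _ _ _ h => FTerm.const.inj h)

theorem FTerm.VarIn.eval_mem {C : Type w} {α : Type*} {l : List (BAtom U B (FTerm C))}
    {t : FTerm C} (ht : t.VarIn (varsOf l)) {ι : C → α} {s : ℕ → α} {Y : Set α}
    (hc : ∀ c, t = .const c → ι c ∈ Y)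
    (h : ∀ A ∈ l, ∀ a ∈ (A.map (FTerm.eval ι s)).args, a ∈ Y) : t.eval ι s ∈ Y := by
  cases t with
  | var x =>
    obtain ⟨A, hA, hx⟩ := ht x rfl
    exact h A hA _ (BAtom.mem_args_map.2 ⟨_, hx, rfl⟩)
  | const c => exact hc c rfl

end Atoms

/-! ### Certain answers -/

section Certain

variable {U : Type u} {B : Type v} {C : Type w}

/-- Certainty quantifies over domains in the universe `max u v w`, so a model on `C` is first
transported to a lifted copy of `C`. -/
theorem Certain.holds_of_satisfied {k : ℕ} {T : TGDTheory U B C} {D : Set (BAtom U B C)}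
    {q : ConjQuery U B C k} {a : Fin k → C} (h : Certain T D q a) {I : Set (BAtom U B C)}
    (hD : D ⊆ I) (hI : T.Satisfied id I) : q.Holds id I a := by
  have key : ∀ (A : BAtom U B (FTerm C)) (s : ℕ → ULift.{max u v} C),
      (A.map (FTerm.eval ULift.up s)).map ULift.down =
        A.map (FTerm.eval id fun x => (s x).down) := by
    intro A s
    rw [BAtom.map_map]
    exact BAtom.map_congr fun t _ => FTerm.apply_eval ULift.down _ _ _
  obtain ⟨s, hs, ha⟩ := h (ULift.{max u v} C) ULift.up {A | A.map ULift.down ∈ I}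
    ULift.up_injective
    (fun A hA => by
      change (A.map ULift.up).map ULift.down ∈ I
      rw [BAtom.map_map, BAtom.map_eq_self fun _ _ => rfl]
      exact hD hA)
    (by
      intro ρ hρ s hs
      obtain ⟨s', h1, h2⟩ := hI ρ hρ (fun x => (s x).down) (fun A hA => by
        have := hs A hA
        rwa [Set.mem_ofPred_eq, key] at this)
      refine ⟨fun x => ⟨s' x⟩, fun x hx => congrArg ULift.up (h1 x hx), ?_⟩
      rw [Set.mem_ofPred_eq, key]
      exact h2)
  refine ⟨fun x => (s x).down, fun A hA => ?_, fun i => ?_⟩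
  · have := hs A hA
    rwa [Set.mem_ofPred_eq, key] at this
  · have := congrArg ULift.down (ha i)
    rwa [FTerm.apply_eval ULift.down] at this

/-- A rewriting that holds in a part of a model is sound for the model, even if the part is
infinite. -/
theorem holds_of_rewriting_holds {k : ℕ} {T : TGDTheory U B C} {q : ConjQuery U B C k}
    {q' : List (ConjQuery U B C k)}
    (hq : ∀ D : Set (BAtom U B C), D.Finite → ∀ a : Fin k → C,
      Certain T D q a ↔ ∃ p ∈ q', p.Holds id D a)
    {S I : Set (BAtom U B C)} (hS : S ⊆ I) (hI : T.Satisfied id I) {p : ConjQuery U B C k}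
    (hp : p ∈ q') {a : Fin k → C} (h : p.Holds id S a) : q.Holds id I a := by
  obtain ⟨s, hs, ha⟩ := h
  -- A match uses only finitely many facts, and these form a legitimate database instance.
  set D : Set (BAtom U B C) := (fun A => A.map (FTerm.eval id s)) '' {A | A ∈ p.body} with hD
  have hfin : D.Finite := p.body.finite_toSet.image _
  have hDS : D ⊆ S := by
    rintro _ ⟨A, hA, rfl⟩
    exact hs A hA
  exact ((hq D hfin a).2 ⟨p, hp, s, fun A hA => ⟨A, hA, rfl⟩, ha⟩).holds_of_satisfied
    (hDS.trans hS) hI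

/-- The closure of a set of facts under the datalog rules of a theory. -/
inductive DatalogClosure (T : TGDTheory U B C) (M : Set (BAtom U B C)) : Set (BAtom U B C)
  | base (A : BAtom U B C) (h : A ∈ M) : DatalogClosure T M A
  | rule (ρ : TGDRule U B C) (hρ : ρ ∈ T.rules) (hd : IsDatalogHead (varsOf ρ.body) ρ.head)
      (s : ℕ → C) (h : ∀ A ∈ ρ.body, DatalogClosure T M (A.map (FTerm.eval id s))) :
      DatalogClosure T M (ρ.head.map (FTerm.eval id s))

theorem DatalogClosure.subset_closed {T : TGDTheory U B C} {M : Set (BAtom U B C)} :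
    M ⊆ DatalogClosure T M := fun A hA => .base A hA

/-- A datalog head has no existential variable, so the head atom that a model must contain is
determined by the body match. -/
theorem DatalogClosure.map_mem {T : TGDTheory U B C} {M : Set (BAtom U B C)} {α : Type*}
    {ι : C → α} {I : Set (BAtom U B α)} (hM : ∀ A ∈ M, A.map ι ∈ I) (hI : T.Satisfied ι I)
    {A : BAtom U B C} (hA : A ∈ DatalogClosure T M) : A.map ι ∈ I := by
  induction hA with
  | base A h => exact hM A h
  | rule ρ hρ hd s h ih =>
    have key : ∀ A : BAtom U B (FTerm C), (A.map (FTerm.eval id s)).map ι =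
        A.map (FTerm.eval ι fun x => ι (s x)) := by
      intro A
      rw [BAtom.map_map]
      exact BAtom.map_congr fun t _ => FTerm.apply_eval _ _ _ _
    obtain ⟨s', h1, h2⟩ := hI ρ hρ (fun x => ι (s x)) fun A hA => by
      rw [← key]; exact ih A hA
    rw [key]
    rwa [BAtom.map_congr fun t ht => (hd t ht).eval_congr h1] at h2

theorem DatalogClosure.certain {T : TGDTheory U B C} {M : Set (BAtom U B C)} {k : ℕ}
    {q : ConjQuery U B C k} {a : Fin k → C} (h : q.Holds id (DatalogClosure T M) a) :
    Certain T M q a := by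
  intro α ι I _ hM hI
  obtain ⟨s, hs, ha⟩ := h
  refine ⟨fun x => ι (s x), fun A hA => ?_, fun i => ?_⟩
  · have := DatalogClosure.map_mem hM hI (hs A hA)
    rw [BAtom.map_map] at this
    rwa [BAtom.map_congr fun t _ => FTerm.apply_eval ι id s t] at this
  · change _ = ι (a i)
    rw [← ha i, FTerm.apply_eval ι]
    rfl

theorem DatalogClosure.args_mem {T : TGDTheory U B C} {M : Set (BAtom U B C)} {Y : Set C}
    (hT : T.consts ⊆ Y) (hM : ∀ A ∈ M, ∀ a ∈ A.args, a ∈ Y) {A : BAtom U B C}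
    (hA : A ∈ DatalogClosure T M) : ∀ a ∈ A.args, a ∈ Y := by
  induction hA with
  | base A h => exact hM A h
  | rule ρ hρ hd s h ih =>
    intro a ha
    obtain ⟨t, ht, rfl⟩ := BAtom.mem_args_map.1 ha
    exact (hd t ht).eval_mem (fun c hc => hT ⟨ρ, hρ, ρ.head, by simp, by subst hc; exact ht⟩) ih

theorem DatalogClosure.finite {T : TGDTheory U B C} {M : Set (BAtom U B C)} (hM : M.Finite) :
    (DatalogClosure T M).Finite := by
  set Y : Set C := {a | ∃ A ∈ M, a ∈ A.args} ∪ T.consts with hY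
  have hYf : Y.Finite := (BAtom.finite_args_of_finite hM).union T.finite_consts
  refine (hM.union (T.finite.biUnion fun ρ _ => ρ.head.finite_setOf_map hYf)).subset ?_
  intro A hA
  have hargs := DatalogClosure.args_mem (Y := Y) Set.subset_union_right
    (fun A hA a ha => Or.inl ⟨A, hA, ha⟩) hA
  cases hA with
  | base A h => exact Or.inl h
  | rule ρ hρ hd s h => exact Or.inr (Set.mem_biUnion hρ ⟨_, rfl, hargs⟩)

end Certain

/-! ### The chase is a model -/

section Chase

variable {U : Type u} {B : Type v} {C : Type w}

/-- A body is finite, hence matched at a finite stage; there the head either holds already or is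
added at the next stage. -/
theorem chase_satisfied (T : TGDTheory U B C) (D : Set (BAtom U B C)) :
    T.Satisfied ChaseElem.const (chase T D) := by
  intro ρ hρ s hs
  have hmono : Monotone fun i => (chaseStep T)^[i] (BAtom.map ChaseElem.const '' D) := by
    refine monotone_nat_of_le_succ fun i => ?_
    rw [Function.iterate_succ_apply']
    exact Set.subset_union_left
  have hstage : ∀ l : List (BAtom U B (FTerm C)), ConjHolds .const (chase T D) l s →
      ∃ i, ConjHolds .const ((chaseStep T)^[i] (BAtom.map ChaseElem.const '' D)) l s := by
    intro l
    induction l with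
    | nil => exact fun _ => ⟨0, fun A hA => by simp at hA⟩
    | cons A l ih =>
      intro h
      obtain ⟨i, hi⟩ := ih fun A' hA' => h A' (List.mem_cons_of_mem _ hA')
      obtain ⟨j, hj⟩ := Set.mem_iUnion.1 (h A List.mem_cons_self)
      refine ⟨max i j, fun A' hA' => ?_⟩
      rcases List.mem_cons.1 hA' with rfl | hA'
      · exact hmono (le_max_right i j) hj
      · exact hmono (le_max_left i j) (hi A' hA')
  obtain ⟨i, hi⟩ := hstage _ hs
  by_cases hh : ρ.HeadHolds .const ((chaseStep T)^[i] (BAtom.map ChaseElem.const '' D)) s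
  · obtain ⟨s', h1, h2⟩ := hh
    exact ⟨s', h1, Set.mem_iUnion.2 ⟨i, h2⟩⟩
  · refine ⟨ρ.extend s, fun x hx => by simp [TGDRule.extend, hx], Set.mem_iUnion.2 ⟨i + 1, ?_⟩⟩
    rw [Function.iterate_succ_apply']
    exact Or.inr ⟨ρ, hρ, s, hi, hh, rfl⟩

end Chase

/-! ### Forests of Skolem terms -/

section Reach

/-- `Reach r n x y`: there is an `r`-path with `n` steps from `x` to `y`. -/
inductive Reach {α : Type*} (r : α → α → Prop) : ℕ → α → α → Prop
  | refl (x : α) : Reach r 0 x x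
  | step {n : ℕ} {x y z : α} (h : Reach r n x y) (hr : r y z) : Reach r (n + 1) x z

variable {α : Type*} {r : α → α → Prop}

theorem Reach.trans {n k : ℕ} {x y z : α} (h : Reach r n x y) (h' : Reach r k y z) :
    Reach r (n + k) x z := by
  induction h' with
  | refl => exact h
  | step _ hr ih => exact .step (ih h) hr

theorem Reach.symm (hr : ∀ x y, r x y → r y x) {n : ℕ} {x y : α} (h : Reach r n x y) :
    Reach r n y x := by
  induction h with
  | refl => exact .refl _
  | @step n x y z _ h ih =>
    have := (Reach.step (.refl z) (hr _ _ h)).trans ih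
    rwa [show 0 + 1 + n = n + 1 by omega] at this

theorem Reach.of_eqvGen (hr : ∀ x y, r x y → r y x) {x y : α} (h : Relation.EqvGen r x y) :
    ∃ n, Reach r n x y := by
  induction h with
  | rel x y h => exact ⟨1, .step (.refl x) h⟩
  | refl x => exact ⟨0, .refl x⟩
  | symm x y _ ih => exact ⟨ih.choose, ih.choose_spec.symm hr⟩
  | trans x y z _ _ ih ih' =>
    obtain ⟨n, hn⟩ := ih
    obtain ⟨k, hk⟩ := ih'
    exact ⟨n + k, hn.trans hk⟩

/-- For a symmetric relation one can choose a base point in each connected component. -/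
theorem Reach.exists_base (hr : ∀ x y, r x y → r y x) :
    ∃ b : α → α, (∀ x y, r x y → b x = b y) ∧ ∀ x, ∃ n, Reach r n (b x) x :=
  ⟨fun x => (Quot.mk r x).out, fun _ _ h => congrArg Quot.out (Quot.sound h),
    fun _ => Reach.of_eqvGen hr (Quot.eqvGen_exact (Quot.out_eq _))⟩

end Reach

/-- A coding of all the constants as words over `m` letters, each starting in a constant, where the
constants in `K` are coded by themselves. -/
structure Forest (C : Type w) (K : Set C) (m : ℕ) where
  code : C ≃ C × List (Fin m)
  code_const : ∀ k ∈ K, code k = (k, [])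

namespace Forest

variable {C : Type w} {K : Set C} {m : ℕ}

-- Both `C` and the set of coded words have the cardinality of `C`, and removing a finite set from
-- either does not change it; so the prescribed coding of `K` extends to a bijection.
open Cardinal in
theorem nonempty [Infinite C] (hK : K.Finite) (m : ℕ) : Nonempty (Forest C K m) := by
  classical
  let j : K → C × List (Fin m) := fun k => (k.1, [])
  have hj : Function.Injective j := fun a b h => Subtype.ext (congrArg Prod.fst h)
  have hX : #(C × List (Fin m)) = #C := by
    rw [Cardinal.mk_prod, Cardinal.lift_uzero]
    exact Cardinal.mul_eq_left (Cardinal.aleph0_le_mk C)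
      ((Cardinal.lift_le_aleph0.2 (Cardinal.mk_le_aleph0)).trans (Cardinal.aleph0_le_mk C))
      (by simp)
  have : Finite K := hK
  have h1 : #(Kᶜ : Set C) = #C :=
    Cardinal.mk_compl_of_infinite K ((Cardinal.lt_aleph0_of_finite K).trans_le
      (Cardinal.aleph0_le_mk C))
  have h2 : #((Set.range j)ᶜ : Set (C × List (Fin m))) = #(C × List (Fin m)) :=
    Cardinal.mk_compl_of_infinite _ ((Cardinal.lt_aleph0_of_finite _).trans_le
      (Cardinal.aleph0_le_mk _))
  obtain ⟨e⟩ := Cardinal.eq.1 ((h1.trans hX.symm).trans h2.symm)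
  refine ⟨⟨(Equiv.Set.sumCompl K).symm.trans
    (((Equiv.ofInjective j hj).sumCongr e).trans (Equiv.Set.sumCompl (Set.range j))), ?_⟩⟩
  intro k hk
  simp [Equiv.Set.sumCompl_symm_apply_of_mem hk, j]

variable (Φ : Forest C K m)

/-- The `i`-th child. -/
def nul (i : Fin m) (c : C) : C := Φ.code.symm ((Φ.code c).1, i :: (Φ.code c).2)

/-- The parent. -/
def par (c : C) : C := Φ.code.symm ((Φ.code c).1, (Φ.code c).2.tail)

theorem code_nul (i : Fin m) (c : C) : Φ.code (Φ.nul i c) = ((Φ.code c).1, i :: (Φ.code c).2) := by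
  simp [nul]

theorem par_nul (i : Fin m) (c : C) : Φ.par (Φ.nul i c) = c := by
  simp [par, code_nul]

theorem nul_ne (i : Fin m) (c : C) : Φ.nul i c ≠ c := by
  intro h
  have := congrArg (fun x => (Φ.code x).2.length) h
  simp [code_nul] at this

/-- The constants whose word starts in `K`. -/
def trees : Set C := {c | (Φ.code c).1 ∈ K}

theorem const_mem_trees {k : C} (hk : k ∈ K) : k ∈ Φ.trees := by
  change (Φ.code k).1 ∈ K
  rwa [Φ.code_const k hk]

theorem nul_mem_trees {i : Fin m} {c : C} : Φ.nul i c ∈ Φ.trees ↔ c ∈ Φ.trees := by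
  change (Φ.code _).1 ∈ K ↔ _
  rw [code_nul]
  rfl

/-- Neighbours: equal elements, parent and child, and pairs of roots. -/
def Adj (x y : C) : Prop :=
  x = y ∨ (∃ i, y = Φ.nul i x) ∨ (∃ i, x = Φ.nul i y) ∨ ((Φ.code x).2 = [] ∧ (Φ.code y).2 = [])

theorem Adj.symm {x y : C} (h : Φ.Adj x y) : Φ.Adj y x := by
  rcases h with h | h | h | h
  · exact .inl h.symm
  · exact .inr (.inr (.inl h))
  · exact .inr (.inl h)
  · exact .inr (.inr (.inr h.symm))

/-- The shape of the words of two elements at distance at most `n`. -/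
def Near (n : ℕ) (x y : C) : Prop :=
  ((Φ.code x).2.length ≤ n ∧ (Φ.code y).2.length ≤ n) ∨
    ((Φ.code x).1 = (Φ.code y).1 ∧ ∃ a b z, a.length ≤ n ∧ b.length ≤ n ∧
      (Φ.code x).2 = a ++ z ∧ (Φ.code y).2 = b ++ z)

theorem near_of_reach {n : ℕ} {x y : C} (h : Reach Φ.Adj n x y) : Φ.Near n x y := by
  induction h with
  | refl x => exact .inr ⟨rfl, [], [], _, by simp, by simp, rfl, rfl⟩
  | @step n x y w _ h ih =>
    rcases h with rfl | ⟨i, rfl⟩ | ⟨i, rfl⟩ | ⟨h1, h2⟩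
    · rcases ih with ⟨h1, h2⟩ | ⟨h1, a, b, z, ha, hb, h2, h3⟩
      · exact .inl ⟨by omega, by omega⟩
      · exact .inr ⟨h1, a, b, z, by omega, by omega, h2, h3⟩
    · rcases ih with ⟨h1, h2⟩ | ⟨h1, a, b, z, ha, hb, h2, h3⟩
      · exact .inl ⟨by omega, by simp [code_nul]; omega⟩
      · exact .inr ⟨by simp [code_nul, h1], a, i :: b, z, by omega, by simp; omega, h2,
          by simp [code_nul, h3]⟩
    · rcases ih with ⟨h1, h2⟩ | ⟨h1, a, b, z, ha, hb, h2, h3⟩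
      · exact .inl ⟨by omega, by simp [code_nul] at h2; omega⟩
      · rw [code_nul] at h1 h3
        cases b with
        -- The current element is the common ancestor; moving to its parent transfers one letter
        -- from the common suffix `z` to `a`.
        | nil =>
          refine .inr ⟨h1, a ++ [i], [], (Φ.code w).2, by simp; omega, by simp, ?_, rfl⟩
          simp only [List.nil_append] at h3
          simp [h2, ← h3]
        | cons i' b =>
          simp only [List.cons_append, List.cons.injEq] at h3
          simp only [List.length_cons] at hb
          exact .inr ⟨h1, a, b, z, by omega, by omega, h2, h3.2⟩
    · rcases ih with ⟨h3, h4⟩ | ⟨h3, a, b, z, ha, hb, h4, h5⟩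
      · exact .inl ⟨by omega, by simp [h2]⟩
      · rw [h1] at h5
        obtain ⟨rfl, rfl⟩ := List.append_eq_nil_iff.1 h5.symm
        exact .inl ⟨by simp [h4]; omega, by simp [h2]⟩

open Classical in
/-- A colouring with finitely many colours, which separates elements of the trees at distance at
most `N`. -/
noncomputable def color (N : ℕ) (c : C) :
    Option K × Fin (N + 1) × {l : List (Fin m) // l.length ≤ N} :=
  (if h : (Φ.code c).1 ∈ K then some ⟨_, h⟩ else none, Fin.ofNat (N + 1) (Φ.code c).2.length,
    ⟨(Φ.code c).2.take N, by simp⟩)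

theorem color_eq {N : ℕ} {x y : C} (hy : y ∈ Φ.trees) (h : Φ.color N x = Φ.color N y) :
    (Φ.code x).1 = (Φ.code y).1 ∧ (Φ.code x).2.length ≡ (Φ.code y).2.length [MOD N + 1] ∧
      (Φ.code x).2.take N = (Φ.code y).2.take N := by
  simp only [color, Prod.mk.injEq, Subtype.mk.injEq] at h
  obtain ⟨h1, h2, h3⟩ := h
  refine ⟨?_, congrArg Fin.val h2, h3⟩
  rw [dif_pos (show (Φ.code y).1 ∈ K from hy)] at h1
  split_ifs at h1
  exact congrArg Subtype.val (Option.some.inj h1)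

/-- Letters are added at the front, so nearby elements have short words or share a long suffix. In
the latter case the differing prefixes have length at most `N`; equal lengths modulo `N + 1` make
these lengths equal, and the first `N` letters then make the prefixes equal. -/
theorem eq_of_color_eq {N n : ℕ} (hn : n ≤ N) {x y : C} (hy : y ∈ Φ.trees)
    (h : Φ.color N x = Φ.color N y) (hxy : Reach Φ.Adj n x y) : x = y := by
  obtain ⟨h1, h2, h3⟩ := Φ.color_eq hy h
  refine Φ.code.injective (Prod.ext h1 ?_)
  rcases Φ.near_of_reach hxy with ⟨h4, h5⟩ | ⟨-, a, b, z, ha, hb, h4, h5⟩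
  · rwa [List.take_of_length_le (h4.trans hn), List.take_of_length_le (h5.trans hn)] at h3
  · rw [h4, h5] at h2 h3 ⊢
    simp only [List.length_append] at h2
    have hab : a.length = b.length :=
      (Nat.ModEq.add_right_cancel' _ h2).eq_of_lt_of_lt (by omega) (by omega)
    have := congrArg (List.take a.length) h3
    rw [List.take_take, List.take_take, min_eq_left (ha.trans hn), List.take_left, hab,
      List.take_left] at this
    rw [this]

theorem eq_const_of_color_eq {N : ℕ} (hN : 0 < N) {x k : C} (hk : k ∈ K)
    (h : Φ.color N x = Φ.color N k) : x = k := by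
  obtain ⟨h1, -, h3⟩ := Φ.color_eq (Φ.const_mem_trees hk) h
  refine Φ.code.injective (Prod.ext h1 ?_)
  rw [Φ.code_const k hk] at h3 ⊢
  simpa [hN.ne'] using h3

theorem eq_nul_of_color_eq {N : ℕ} (hN : 0 < N) {x y : C} {i : Fin m} (hy : y ∈ Φ.trees)
    (h : Φ.color N x = Φ.color N (Φ.nul i y)) : ∃ x', x = Φ.nul i x' := by
  obtain ⟨-, -, h3⟩ := Φ.color_eq (Φ.nul_mem_trees.2 hy) h
  rw [code_nul] at h3
  obtain ⟨N, rfl⟩ := Nat.exists_eq_succ_of_ne_zero hN.ne'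
  refine ⟨Φ.par x, Φ.code.injective ?_⟩
  rw [code_nul]
  cases hx : (Φ.code x).2 with
  | nil => simp [hx] at h3
  | cons i' l =>
    simp only [hx, List.take_succ_cons, List.cons.injEq, Nat.succ_eq_add_one] at h3
    exact Prod.ext (by simp [par]) (by simp [par, hx, h3.1])

/-! ### Bounded bisimilarity -/

variable {Λ : Type v} (lab : C → Λ)

/-- Indistinguishability by the labels of the elements at the end of short paths. -/
def Bisim : ℕ → C → C → Prop
  | 0, x, y => lab x = lab y
  | k + 1, x, y => lab x = lab y ∧ (∀ i, Bisim k (Φ.nul i x) (Φ.nul i y)) ∧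
      Bisim k (Φ.par x) (Φ.par y)

variable {Φ lab}

theorem Bisim.lab_eq {k : ℕ} {x y : C} (h : Φ.Bisim lab k x y) : lab x = lab y := by
  cases k with
  | zero => exact h
  | succ k => exact h.1

theorem Bisim.refl {k : ℕ} (x : C) : Φ.Bisim lab k x x := by
  induction k generalizing x with
  | zero => rfl
  | succ k ih => exact ⟨rfl, fun i => ih _, ih _⟩

theorem Bisim.symm {k : ℕ} {x y : C} (h : Φ.Bisim lab k x y) : Φ.Bisim lab k y x := by
  induction k generalizing x y with
  | zero => exact Eq.symm h
  | succ k ih => exact ⟨h.1.symm, fun i => ih (h.2.1 i), ih h.2.2⟩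

theorem Bisim.trans {k : ℕ} {x y z : C} (h : Φ.Bisim lab k x y) (h' : Φ.Bisim lab k y z) :
    Φ.Bisim lab k x z := by
  induction k generalizing x y z with
  | zero => exact Eq.trans h h'
  | succ k ih => exact ⟨h.1.trans h'.1, fun i => ih (h.2.1 i) (h'.2.1 i), ih h.2.2 h'.2.2⟩

theorem Bisim.pred {k : ℕ} {x y : C} (h : Φ.Bisim lab (k + 1) x y) : Φ.Bisim lab k x y := by
  induction k generalizing x y with
  | zero => exact h.1
  | succ k ih => exact ⟨h.1, fun i => ih (h.2.1 i), ih h.2.2⟩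

variable (Φ lab)

theorem exists_finite_classifier [Finite Λ] (k : ℕ) :
    ∃ (β : Type v) (_ : Finite β) (τ : C → β), ∀ x y, τ x = τ y → Φ.Bisim lab k x y := by
  induction k with
  | zero => exact ⟨Λ, inferInstance, lab, fun x y h => h⟩
  | succ k ih =>
    obtain ⟨β, hβ, τ, hτ⟩ := ih
    -- The type of depth `k + 1` consists of the label and the depth `k` types of the finitely many
    -- children and of the parent.
    refine ⟨Λ × (Fin m → β) × β, inferInstance,
      fun x => (lab x, fun i => τ (Φ.nul i x), τ (Φ.par x)), fun x y h => ?_⟩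
    simp only [Prod.mk.injEq] at h
    exact ⟨h.1, fun i => hτ _ _ (congrFun h.2.1 i), hτ _ _ h.2.2⟩

/-- A retraction with finite range which moves each element to a bisimilar one. -/
theorem exists_retraction [Nonempty C] [Finite Λ] (k : ℕ) :
    ∃ r : C → C, (Set.range r).Finite ∧ (∀ x, r (r x) = r x) ∧ ∀ x, Φ.Bisim lab k (r x) x := by
  obtain ⟨β, hβ, τ, hτ⟩ := Φ.exists_finite_classifier lab k
  have hr : ∀ x, τ (Function.invFun τ (τ x)) = τ x := fun x => Function.invFun_eq ⟨x, rfl⟩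
  refine ⟨fun x => Function.invFun τ (τ x), ?_, fun x => ?_, fun x => hτ _ _ (hr x)⟩
  · exact (Set.finite_range (Function.invFun τ)).subset (by rintro _ ⟨x, rfl⟩; exact ⟨_, rfl⟩)
  · simp only [hr]

end Forest

/-! ### Existential rules -/

section Skolem

variable {U : Type u} {B : Type v} {C : Type w}

/-- An existential head is obtained from a two-element pattern by inserting the existential
variable and a term over the body, which is the constant `c₀` if it does not occur. -/
theorem IsExistentialHead.exists_shape {V : Set ℕ} {A : BAtom U B (FTerm C)}
    (h : IsExistentialHead V A) (c₀ : C) :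
    ∃ (t : FTerm C) (z : ℕ) (H : BAtom U B Bool), t.VarIn V ∧
      (∀ c, t = .const c → c = c₀ ∨ c ∈ A.consts) ∧ z ∉ V ∧
      A = H.map (fun b => bif b then .var z else t) := by
  cases A with
  | un P t =>
    obtain ⟨x, rfl, hx⟩ := h
    refine ⟨.const c₀, x, .un P true, fun x h => by simp at h, fun c h => ?_, hx, rfl⟩
    exact .inl (FTerm.const.inj h).symm
  | bin R t t' =>
    rcases h with ⟨⟨x, rfl, hx⟩, h⟩ | ⟨h, ⟨x, rfl, hx⟩⟩
    · refine ⟨t', x, .bin R true false, h, fun c hc => .inr ?_, hx, rfl⟩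
      simp [BAtom.consts, BAtom.args, hc]
    · refine ⟨t, x, .bin R false true, h, fun c hc => .inr ?_, hx, rfl⟩
      simp [BAtom.consts, BAtom.args, hc]

/-- An enumeration of the existential rules of a theory, with their heads decomposed. -/
structure ExistentialRules (T : TGDTheory U B C) (c₀ : C) (m : ℕ) where
  rule : Fin m → TGDRule U B C
  frontier : Fin m → FTerm C
  newVar : Fin m → ℕ
  shape : Fin m → BAtom U B Bool
  mem : ∀ i, rule i ∈ T.rules
  frontier_varIn : ∀ i, (frontier i).VarIn (varsOf (rule i).body)
  frontier_const : ∀ i c, frontier i = .const c → c = c₀ ∨ c ∈ T.consts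
  newVar_notMem : ∀ i, newVar i ∉ varsOf (rule i).body
  head_eq : ∀ i, (rule i).head = (shape i).map (fun b => bif b then .var (newVar i) else frontier i)
  complete : ∀ ρ ∈ T.rules, ¬ IsDatalogHead (varsOf ρ.body) ρ.head → ∃ i, rule i = ρ

theorem exists_existentialRules (T : TGDTheory U B C) (c₀ : C) :
    ∃ m, Nonempty (ExistentialRules T c₀ m) := by
  have hfin : Finite {ρ // ρ ∈ T.rules ∧ ¬ IsDatalogHead (varsOf ρ.body) ρ.head} :=
    T.finite.subset fun ρ h => h.1
  obtain ⟨m, ⟨e⟩⟩ := Finite.exists_equiv_fin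
    {ρ // ρ ∈ T.rules ∧ ¬ IsDatalogHead (varsOf ρ.body) ρ.head}
  have h : ∀ i, IsExistentialHead (varsOf (e.symm i).1.body) (e.symm i).1.head := fun i =>
    (e.symm i).1.wf.resolve_left (e.symm i).2.2
  choose t z H h1 h2 h3 h4 using fun i => (h i).exists_shape c₀
  refine ⟨m, ⟨⟨fun i => (e.symm i).1, t, z, H, fun i => (e.symm i).2.1, h1, fun i c hc => ?_, h3,
    h4, fun ρ hρ hd => ⟨e ⟨ρ, hρ, hd⟩, by simp⟩⟩⟩⟩
  exact (h2 i c hc).imp_right fun h => ⟨_, (e.symm i).2.1, _, List.mem_cons_self, h⟩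

namespace ExistentialRules

variable {T : TGDTheory U B C} {c₀ : C} {m : ℕ} (R : ExistentialRules T c₀ m)

/-- The head of the `i`-th rule for the frontier element `e` and the witness `f`. -/
def atom {α : Type*} (i : Fin m) (e f : α) : BAtom U B α :=
  (R.shape i).map (fun b => bif b then f else e)

theorem map_atom {α β : Type*} (g : α → β) (i : Fin m) (e f : α) :
    (R.atom i e f).map g = R.atom i (g e) (g f) := by
  rw [atom, BAtom.map_map]
  exact BAtom.map_congr fun b _ => by cases b <;> rfl

theorem mem_args_atom {α : Type*} {i : Fin m} {e f a : α} (h : a ∈ (R.atom i e f).args) :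
    a = e ∨ a = f := by
  obtain ⟨b, -, rfl⟩ := BAtom.mem_args_map.1 h
  cases b
  · exact .inl rfl
  · exact .inr rfl

theorem map_head {α : Type*} (ι : C → α) (s : ℕ → α) (i : Fin m) :
    (R.rule i).head.map (FTerm.eval ι s) = R.atom i ((R.frontier i).eval ι s) (s (R.newVar i)) := by
  rw [R.head_eq, BAtom.map_map]
  exact BAtom.map_congr fun b _ => by cases b <;> rfl

theorem headHolds_iff {α : Type*} {ι : C → α} {I : Set (BAtom U B α)} {i : Fin m} {s : ℕ → α} :
    (R.rule i).HeadHolds ι I s ↔ ∃ f, R.atom i ((R.frontier i).eval ι s) f ∈ I := by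
  constructor
  · rintro ⟨s', h1, h2⟩
    rw [map_head, (R.frontier_varIn i).eval_congr h1] at h2
    exact ⟨_, h2⟩
  · rintro ⟨f, hf⟩
    have h : ∀ x ∈ varsOf (R.rule i).body, Function.update s (R.newVar i) f x = s x :=
      fun x hx => Function.update_of_ne (ne_of_mem_of_not_mem hx (R.newVar_notMem i)) _ _
    refine ⟨Function.update s (R.newVar i) f, h, ?_⟩
    rw [map_head, (R.frontier_varIn i).eval_congr h, Function.update_self]
    exact hf

/-- The query asking for the frontier elements at which the `i`-th rule is applicable. -/
def query (i : Fin m) : ConjQuery U B C 1 := ⟨fun _ => R.frontier i, (R.rule i).body⟩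

/-! ### The semi-oblivious chase and its skeleton -/

variable {K : Set C} (Φ : Forest C K m) (D : Set (BAtom U B C))

/-- The semi-oblivious chase: the witness of an existential rule depends on the frontier only, and
it is created even if the head is already satisfied. -/
inductive SkolemChase : Set (BAtom U B C)
  | base (A : BAtom U B C) (h : A ∈ D) : SkolemChase A
  | datalog (ρ : TGDRule U B C) (hρ : ρ ∈ T.rules) (hd : IsDatalogHead (varsOf ρ.body) ρ.head)
      (s : ℕ → C) (h : ∀ A ∈ ρ.body, SkolemChase (A.map (FTerm.eval id s))) :
      SkolemChase (ρ.head.map (FTerm.eval id s))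
  | existential (i : Fin m) (s : ℕ → C)
      (h : ∀ A ∈ (R.rule i).body, SkolemChase (A.map (FTerm.eval id s))) :
      SkolemChase (R.atom i ((R.frontier i).eval id s) (Φ.nul i ((R.frontier i).eval id s)))

/-- The `i`-th rule is applicable at the frontier element `c`. -/
def Fires (i : Fin m) (c : C) : Prop :=
  (R.query i).Holds id (R.SkolemChase Φ D) fun _ => c

/-- The facts of the database and the facts created by existential rules. -/
def skeleton : Set (BAtom U B C) := D ∪ {A | ∃ i c, R.Fires Φ D i c ∧ A = R.atom i c (Φ.nul i c)}

theorem skeleton_subset : R.skeleton Φ D ⊆ R.SkolemChase Φ D := by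
  rintro A (hA | ⟨i, c, ⟨s, hs, hc⟩, rfl⟩)
  · exact .base A hA
  · have hc : (R.frontier i).eval id s = c := hc 0
    subst hc
    exact .existential i s hs

theorem skolemChase_satisfied : T.Satisfied id (R.SkolemChase Φ D) := by
  intro ρ hρ s hs
  by_cases hd : IsDatalogHead (varsOf ρ.body) ρ.head
  · exact ⟨s, fun _ _ => rfl, .datalog ρ hρ hd s hs⟩
  · obtain ⟨i, rfl⟩ := R.complete ρ hρ hd
    exact R.headHolds_iff.2 ⟨_, .existential i s hs⟩

variable {Φ D}

theorem skolemChase_args (hc₀ : c₀ ∈ K) (hT : T.consts ⊆ K) (hD : ∀ A ∈ D, ∀ a ∈ A.args, a ∈ K)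
    {A : BAtom U B C} (hA : A ∈ R.SkolemChase Φ D) : ∀ a ∈ A.args, a ∈ Φ.trees := by
  induction hA with
  | base A h => exact fun a ha => Φ.const_mem_trees (hD A h a ha)
  | datalog ρ hρ hd s h ih =>
    intro a ha
    obtain ⟨t, ht, rfl⟩ := BAtom.mem_args_map.1 ha
    exact (hd t ht).eval_mem (fun c hc => Φ.const_mem_trees
      (hT ⟨ρ, hρ, ρ.head, by simp, by subst hc; exact ht⟩)) ih
  | existential i s h ih =>
    have hf : (R.frontier i).eval id s ∈ Φ.trees := (R.frontier_varIn i).eval_mem (fun c hc =>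
      Φ.const_mem_trees ((R.frontier_const i c hc).elim (fun h => h ▸ hc₀) fun h => hT h)) ih
    intro a ha
    rcases R.mem_args_atom ha with rfl | rfl
    · exact hf
    · exact Φ.nul_mem_trees.2 hf

/-- The semi-oblivious chase is universal. -/
theorem exists_hom (hc₀ : c₀ ∈ K) (hT : T.consts ⊆ K) (hD : ∀ A ∈ D, ∀ a ∈ A.args, a ∈ K)
    {α : Type*} [Nonempty α] {ι : C → α} {J : Set (BAtom U B α)} (hDJ : ∀ A ∈ D, A.map ι ∈ J)
    (hJ : T.Satisfied ι J) : ∃ h : C → α, ∀ A ∈ R.SkolemChase Φ D, A.map h ∈ J := by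
  -- Recursion along words, choosing a witness in `J` for each letter. The choice is arbitrary where
  -- no witness exists, which never happens at an applied rule.
  let h : C → α := fun x => (Φ.code x).2.foldr
    (fun i e => Classical.epsilon fun f => R.atom i e f ∈ J) (ι (Φ.code x).1)
  have hK : ∀ k ∈ K, h k = ι k := fun k hk => by simp [h, Φ.code_const k hk]
  have hnul : ∀ i x, h (Φ.nul i x) = Classical.epsilon fun f => R.atom i (h x) f ∈ J :=
    fun i x => by simp [h, Φ.code_nul]
  have heval : ∀ s (t : FTerm C), (∀ c, t = .const c → c ∈ K) →
      h (t.eval id s) = t.eval ι fun x => h (s x) := by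
    intro s t ht
    rw [FTerm.apply_eval h]
    exact FTerm.eval_congr_ι fun c hc => hK c (ht c hc)
  have hmap : ∀ ρ ∈ T.rules, ∀ A ∈ ρ.head :: ρ.body, ∀ s : ℕ → C,
      (A.map (FTerm.eval id s)).map h = A.map (FTerm.eval ι fun x => h (s x)) := by
    intro ρ hρ A hA s
    rw [BAtom.map_map]
    exact BAtom.map_congr fun t ht => heval s t fun c hc =>
      hT ⟨ρ, hρ, A, hA, by subst hc; exact ht⟩
  refine ⟨h, fun A hA => ?_⟩
  induction hA with
  | base A hA =>
    rw [BAtom.map_congr fun a ha => hK a (hD A hA a ha)]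
    exact hDJ A hA
  | datalog ρ hρ hd s _ ih =>
    obtain ⟨s', h1, h2⟩ := hJ ρ hρ (fun x => h (s x)) fun A hA => by
      rw [← hmap ρ hρ A (List.mem_cons_of_mem _ hA)]
      exact ih A hA
    rw [hmap ρ hρ _ List.mem_cons_self]
    rwa [BAtom.map_congr fun t ht => (hd t ht).eval_congr h1] at h2
  | existential i s _ ih =>
    have := R.headHolds_iff.1 (hJ _ (R.mem i) (fun x => h (s x)) fun A hA => by
      rw [← hmap _ (R.mem i) A (List.mem_cons_of_mem _ hA)]
      exact ih A hA)
    rw [map_atom, hnul, heval s _ fun c hc => (R.frontier_const i c hc).elim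
      (fun h => h ▸ hc₀) fun h => hT h]
    exact Classical.epsilon_spec this

/-! ### Lifting queries from the quotient of the skeleton -/

variable (Φ D)

/-- The label of an element: its colour, whether it occurs as a witness, and the rules applicable
at it. -/
noncomputable def label (N : ℕ) (x : C) :
    (Option K × Fin (N + 1) × {l : List (Fin m) // l.length ≤ N}) × Prop × (Fin m → Prop) :=
  (Φ.color N x, (∃ i, x = Φ.nul i (Φ.par x) ∧ R.Fires Φ D i (Φ.par x)), fun i => R.Fires Φ D i x)

variable {Φ D}

theorem color_eq_of_label_eq {N : ℕ} {x y : C} (h : R.label Φ D N x = R.label Φ D N y) :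
    Φ.color N x = Φ.color N y := congrArg Prod.fst h

theorem fires_of_label_eq {N : ℕ} {x y : C} (h : R.label Φ D N x = R.label Φ D N y) {i : Fin m} :
    R.Fires Φ D i x ↔ R.Fires Φ D i y :=
  iff_of_eq (congrFun (congrArg (fun l => l.2.2) h) i)

/-- The colour reveals the first letter of the word, hence which rule would have created the
element; the witness component of the label says that this rule did fire at the parent. -/
theorem fires_of_label_eq_nul {N : ℕ} (hN : 0 < N) {x c : C} {i : Fin m} (hc : c ∈ Φ.trees)
    (hi : R.Fires Φ D i c) (h : R.label Φ D N x = R.label Φ D N (Φ.nul i c)) :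
    ∃ e, x = Φ.nul i e ∧ R.Fires Φ D i e := by
  obtain ⟨e, rfl⟩ := Φ.eq_nul_of_color_eq hN hc (R.color_eq_of_label_eq h)
  refine ⟨e, rfl, ?_⟩
  obtain ⟨i', h1, h2⟩ := (iff_of_eq (congrArg (fun l => l.2.1) h)).2
    ⟨i, by rw [Φ.par_nul], by rwa [Φ.par_nul]⟩
  rw [Φ.par_nul] at h1 h2
  have := congrArg (fun x => (Φ.code x).2) h1
  simp only [Φ.code_nul, List.cons.injEq, and_true] at this
  rwa [this]

/-- A fact of the skeleton can be moved along bisimilarity. -/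
theorem exists_transfer (hc₀ : c₀ ∈ K) (hT : T.consts ⊆ K) (hD : ∀ A ∈ D, ∀ a ∈ A.args, a ∈ K)
    {N k : ℕ} (hN : 0 < N) {A : BAtom U B C} (hA : A ∈ R.skeleton Φ D) {a x : C}
    (ha : a ∈ A.args) (hx : Φ.Bisim (R.label Φ D N) (k + 1) x a) :
    ∃ φ : C → C, A.map φ ∈ R.skeleton Φ D ∧ φ a = x ∧
      ∀ b ∈ A.args, Φ.Bisim (R.label Φ D N) k (φ b) b ∧ Φ.Adj x (φ b) := by
  classical
  have htrees := R.skolemChase_args hc₀ hT hD (R.skeleton_subset Φ D hA)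
  rcases hA with hA | ⟨i, c, hi, rfl⟩
  · have haK := hD A hA a ha
    -- Elements of `K` are alone in their colour class, so a fact of `D` need not be moved.
    obtain rfl := Φ.eq_const_of_color_eq hN haK (R.color_eq_of_label_eq hx.lab_eq)
    refine ⟨id, ?_, rfl, fun b hb => ⟨.refl b, .inr (.inr (.inr ⟨?_, ?_⟩))⟩⟩
    · rw [BAtom.map_eq_self (f := id) fun _ _ => rfl]
      exact .inl hA
    · rw [Φ.code_const _ haK]
    · rw [id, Φ.code_const _ (hD A hA b hb)]
  -- Here `e` is the new frontier element: it is `x` itself if `a` is the frontier element, and the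
  -- parent of `x` if `a` is the witness.
  · have key : ∀ e, R.Fires Φ D i e → Φ.Bisim (R.label Φ D N) k e c →
        Φ.Bisim (R.label Φ D N) k (Φ.nul i e) (Φ.nul i c) →
        ((x = e ∧ a = c) ∨ (x = Φ.nul i e ∧ a = Φ.nul i c)) →
        ∃ φ : C → C, (R.atom i c (Φ.nul i c)).map φ ∈ R.skeleton Φ D ∧ φ a = x ∧
          ∀ b ∈ (R.atom i c (Φ.nul i c)).args,
            Φ.Bisim (R.label Φ D N) k (φ b) b ∧ Φ.Adj x (φ b) := by
      intro e he h1 h2 h3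
      let φ : C → C := fun b => if b = Φ.nul i c then Φ.nul i e else e
      have hφ1 : φ c = e := if_neg (Φ.nul_ne i c).symm
      have hφ2 : φ (Φ.nul i c) = Φ.nul i e := if_pos rfl
      refine ⟨φ, ?_, ?_, fun b hb => ?_⟩
      · rw [R.map_atom, hφ1, hφ2]
        exact .inr ⟨i, e, he, rfl⟩
      · rcases h3 with ⟨rfl, rfl⟩ | ⟨rfl, rfl⟩
        · exact hφ1
        · exact hφ2
      · rcases R.mem_args_atom hb with rfl | rfl
        · rw [hφ1]
          exact ⟨h1, h3.elim (fun h => .inl h.1) fun h => .inr (.inr (.inl ⟨i, h.1⟩))⟩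
        · rw [hφ2]
          exact ⟨h2, h3.elim (fun h => .inr (.inl ⟨i, by rw [h.1]⟩)) fun h => .inl h.1⟩
    rcases R.mem_args_atom ha with rfl | rfl
    · exact key x ((R.fires_of_label_eq hx.lab_eq).2 hi) hx.pred (hx.2.1 i) (.inl ⟨rfl, rfl⟩)
    · obtain ⟨e, rfl, he⟩ := R.fires_of_label_eq_nul hN
        (Φ.nul_mem_trees.1 (htrees _ ha)) hi hx.lab_eq
      have := hx.2.2
      rw [Φ.par_nul, Φ.par_nul] at this
      exact key e he this hx.pred (.inr ⟨rfl, rfl⟩)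

end ExistentialRules

/-! ### Connected components of queries and lifting of matches -/

theorem BAtom.exists_args_of_map_eq {α β γ : Type*} {f : α → γ} {g : β → γ} {A : BAtom U B α}
    {A' : BAtom U B β} (h : A'.map g = A.map f) {t t' : α} (ht : t ∈ A.args) (ht' : t' ∈ A.args) :
    ∃ a ∈ A'.args, ∃ b ∈ A'.args, g a = f t ∧ g b = f t' := by
  have key : ∀ t ∈ A.args, ∃ a ∈ A'.args, g a = f t := fun t ht =>
    BAtom.mem_args_map.1 (by rw [h]; exact BAtom.mem_args_map.2 ⟨t, ht, rfl⟩)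
  obtain ⟨a, ha, h1⟩ := key t ht
  obtain ⟨b, hb, h2⟩ := key t' ht'
  exact ⟨a, ha, b, hb, h1, h2⟩

/-- Two terms occur in a common atom of the query. -/
def ConjQuery.Linked {k : ℕ} (p : ConjQuery U B C k) (t t' : FTerm C) : Prop :=
  ∃ A ∈ p.body, t ∈ A.args ∧ t' ∈ A.args

/-- The terms of a query. -/
def ConjQuery.terms {k : ℕ} (p : ConjQuery U B C k) : Set (FTerm C) :=
  {t | ∃ A ∈ p.body, t ∈ A.args} ∪ Set.range p.ans

theorem ConjQuery.finite_terms {k : ℕ} (p : ConjQuery U B C k) : p.terms.Finite :=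
  (BAtom.finite_args_of_finite p.body.finite_toSet).union (Set.finite_range _)

theorem ConjQuery.const_mem_consts {k : ℕ} {p : ConjQuery U B C k} {c : C}
    (h : FTerm.const c ∈ p.terms) : c ∈ p.consts := by
  rcases h with ⟨A, hA, h⟩ | ⟨i, h⟩
  · exact .inl ⟨A, hA, h⟩
  · exact .inr ⟨i, h⟩

theorem ConjQuery.exists_radius {k : ℕ} (p : ConjQuery U B C k) :
    ∃ (b : FTerm C → FTerm C) (L : ℕ), (∀ t t', p.Linked t t' → b t = b t') ∧
      ∀ t ∈ p.terms, ∃ n ≤ L, Reach p.Linked n (b t) t := by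
  obtain ⟨b, h1, h2⟩ := Reach.exists_base (r := p.Linked)
    fun t t' ⟨A, hA, h, h'⟩ => ⟨A, hA, h', h⟩
  choose n hn using h2
  obtain ⟨L, hL⟩ := (p.finite_terms.image n).bddAbove
  exact ⟨b, L, h1, fun t ht => ⟨n t, hL ⟨t, ht, rfl⟩, hn t⟩⟩

theorem Forest.Bisim.mono {K : Set C} {m : ℕ} {Φ : Forest C K m} {Λ : Type*} {lab : C → Λ}
    {k n : ℕ} {x y : C} (h : Φ.Bisim lab n x y) (hk : k ≤ n) : Φ.Bisim lab k x y := by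
  induction hk with
  | refl => exact h
  | step _ ih => exact ih h.pred

open Filter in
/-- Matches of a query in a sufficiently fine quotient of the skeleton lift to the skeleton, up to
bisimilarity. -/
theorem ExistentialRules.eventually_lift {T : TGDTheory U B C} {c₀ : C} {m : ℕ}
    (R : ExistentialRules T c₀ m) {K : Set C} {Φ : Forest C K m} {D : Set (BAtom U B C)}
    (hc₀ : c₀ ∈ K) (hT : T.consts ⊆ K) (hD : ∀ A ∈ D, ∀ a ∈ A.args, a ∈ K) {l : ℕ}
    (p : ConjQuery U B C l) (hp : p.consts ⊆ K) :
    ∀ᶠ N in atTop, ∀ r : C → C, (∀ x, Φ.Bisim (R.label Φ D N) N (r x) x) → ∀ a,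
      p.Holds id (BAtom.map r '' R.skeleton Φ D) a →
      ∃ a', p.Holds id (R.skeleton Φ D) a' ∧ ∀ j, R.label Φ D N (a' j) = R.label Φ D N (a j) := by
  obtain ⟨b, L, hb, hL⟩ := p.exists_radius
  -- Two lifted paths of length at most `L` from a common base point, joined by one edge, give a
  -- walk of length at most `2 * L + 1`, within reach of the colouring.
  filter_upwards [eventually_ge_atTop (2 * L + 1)] with N hNL r hr a hpa
  obtain ⟨s, hs, ha⟩ := hpa
  have hN : 0 < N := by omega
  -- A path of linked terms is lifted edge by edge, each edge costing one level of bisimilarity. The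
  -- base term keeps its value.
  have hlift : ∀ {n : ℕ} {t₀ t : FTerm C}, Reach p.Linked n t₀ t → ∀ k, n + k = N →
      ∃ y, Φ.Bisim (R.label Φ D N) k y (t.eval id s) ∧ Reach Φ.Adj n (t₀.eval id s) y := by
    intro n t₀ t h
    induction h with
    | refl t => exact fun k _ => ⟨_, .refl _, .refl _⟩
    | @step n t₀ t t' _ hl ih =>
      intro k hk
      obtain ⟨y, h1, h2⟩ := ih (k + 1) (by omega)
      obtain ⟨A, hA, ht, ht'⟩ := hl
      obtain ⟨A', hA', h⟩ := hs A hA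
      obtain ⟨a, ha, a', ha', e1, e2⟩ := BAtom.exists_args_of_map_eq h ht ht'
      rw [← e1] at h1
      obtain ⟨φ, -, -, hφ⟩ := R.exists_transfer hc₀ hT hD hN hA' ha
        (h1.trans ((hr a).mono (by omega)))
      rw [← e2]
      exact ⟨φ a', (hφ a' ha').1.trans ((hr a').symm.mono (by omega)), h2.step (hφ a' ha').2⟩
  have hex : ∀ t, ∃ y, t ∈ p.terms → ∃ n ≤ L, Φ.Bisim (R.label Φ D N) (L + 1) y (t.eval id s) ∧
      Reach Φ.Adj n ((b t).eval id s) y := by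
    intro t
    by_cases ht : t ∈ p.terms
    · obtain ⟨n, hn, h⟩ := hL t ht
      obtain ⟨y, h1, h2⟩ := hlift h (N - n) (by omega)
      exact ⟨y, fun _ => ⟨n, hn, h1.mono (by omega), h2⟩⟩
    · exact ⟨t.eval id s, fun h => absurd h ht⟩
  choose g hg using hex
  have hgeval : ∀ t ∈ p.terms, t.eval id (fun x => g (.var x)) = g t := by
    intro t ht
    cases t with
    | var x => rfl
    | const c =>
      obtain ⟨n, -, h, -⟩ := hg _ ht
      exact (Φ.eq_const_of_color_eq hN (hp (ConjQuery.const_mem_consts ht))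
        (R.color_eq_of_label_eq h.lab_eq)).symm
  refine ⟨fun j => g (p.ans j), ⟨fun x => g (.var x), fun A hA => ?_,
    fun j => hgeval _ (.inr ⟨j, rfl⟩)⟩, fun j => ?_⟩
  · have hterms : ∀ t ∈ A.args, t ∈ p.terms := fun t ht => .inl ⟨A, hA, ht⟩
    rw [BAtom.map_congr fun t ht => hgeval t (hterms t ht)]
    obtain ⟨A', hA', h⟩ := hs A hA
    have hmove : ∀ t ∈ A.args, ∀ a ∈ A'.args, r a = t.eval id s →
        ∃ φ : C → C, A'.map φ ∈ R.skeleton Φ D ∧ φ a = g t ∧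
          ∀ b ∈ A'.args, Φ.Bisim (R.label Φ D N) L (φ b) b ∧ Φ.Adj (g t) (φ b) := by
      intro t ht a ha e
      obtain ⟨n, -, h1, -⟩ := hg t (hterms t ht)
      rw [← e] at h1
      exact R.exists_transfer hc₀ hT hD hN hA' ha (h1.trans ((hr a).mono (by omega)))
    cases A with
    | un P t =>
      cases A' with
      | bin => simp [BAtom.map] at h
      | un P' a =>
        simp only [BAtom.map, BAtom.un.injEq] at h
        obtain ⟨φ, h1, h2, -⟩ := hmove t (by simp [BAtom.args]) a (by simp [BAtom.args]) h.2
        rw [BAtom.map, h2, h.1] at h1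
        exact h1
    | bin Q t t' =>
      cases A' with
      | un => simp [BAtom.map] at h
      | bin Q' a a' =>
        simp only [BAtom.map, BAtom.bin.injEq] at h
        obtain ⟨rfl, e1, e2⟩ := h
        obtain ⟨φ, h1, h2, h3⟩ := hmove t (by simp [BAtom.args]) a (by simp [BAtom.args]) e1
        obtain ⟨h4, h5⟩ := h3 a' (by simp [BAtom.args])
        rw [BAtom.map, h2] at h1
        obtain ⟨n, hn, -, h6⟩ := hg t (hterms t (by simp [BAtom.args]))
        obtain ⟨n', hn', h7, h8⟩ := hg t' (hterms t' (by simp [BAtom.args]))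
        have hbase : b t = b t' :=
          hb t t' ⟨_, hA, by simp [BAtom.args], by simp [BAtom.args]⟩
        rw [hbase] at h6
        -- The value `g t'` chosen along its own path agrees with the end of the fact moved to `g
        -- t`: both have the same colour and both are near the base point.
        have heq : g t' = φ a' := by
          refine Φ.eq_of_color_eq (N := N) (n := n' + (n + 1)) (by omega) ?_ ?_
            ((h8.symm fun _ _ => Forest.Adj.symm Φ).trans (h6.step h5))
          · exact R.skolemChase_args hc₀ hT hD (R.skeleton_subset Φ D h1) _
              (by simp [BAtom.args])
          · rw [← e2] at h7
            exact R.color_eq_of_label_eq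
              ((h7.lab_eq.trans (hr a').lab_eq).trans h4.lab_eq.symm)
        rw [BAtom.map, heq]
        exact h1
  · obtain ⟨n, -, h, -⟩ := hg (p.ans j) (.inr ⟨j, rfl⟩)
    rw [← ha j]
    exact h.lab_eq

end Skolem

/-! ### The finite model -/

open Filter in
theorem theorem2 {U : Type u} {B : Type v} {C : Type w} [Infinite C]
    (T : TGDTheory U B C) (hBDD : T.IsBDD) (F : B) (hF : T.HasGoalRule F)
    (D : Set (BAtom U B C)) (hD : D.Finite)
    (hchase : ∀ A ∈ chase T D, ¬ A.HasPred F) :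
    ∃ M : Set (BAtom U B C), M.Finite ∧ D ⊆ M ∧ T.Satisfied id M ∧
      ∀ A ∈ M, ¬ A.HasPred F := by
  obtain ⟨c₀⟩ : Nonempty C := inferInstance
  obtain ⟨m, ⟨R⟩⟩ := exists_existentialRules T c₀
  choose q' hq' using fun i => hBDD 1 (R.query i)
  -- The constants of the rewritings are included so that lifted matches fix them. The rewritings
  -- depend on `T` alone, so `K` and `N` can be chosen after them.
  set K : Set C := {a | ∃ A ∈ D, a ∈ A.args} ∪ T.consts ∪ {c₀} ∪
    ⋃ i, ⋃ p ∈ {p | p ∈ q' i}, p.consts with hK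
  have hKfin : K.Finite :=
    (((BAtom.finite_args_of_finite hD).union T.finite_consts).union (Set.finite_singleton _)).union
      (Set.finite_iUnion fun i => (q' i).finite_toSet.biUnion fun p _ => p.finite_consts)
  have hDK : ∀ A ∈ D, ∀ a ∈ A.args, a ∈ K := fun A hA a ha => .inl (.inl (.inl ⟨A, hA, ha⟩))
  have hTK : T.consts ⊆ K := fun c hc => .inl (.inl (.inr hc))
  have hc₀ : c₀ ∈ K := .inl (.inr rfl)
  have hqK : ∀ i, ∀ p ∈ q' i, p.consts ⊆ K := fun i p hp c hc =>
    .inr (Set.mem_iUnion.2 ⟨i, Set.mem_biUnion hp hc⟩)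
  obtain ⟨Φ⟩ := Forest.nonempty hKfin m
  have hev := eventually_all.2 fun i => (eventually_all_finite (q' i).finite_toSet).2 fun p hp =>
    R.eventually_lift (Φ := Φ) hc₀ hTK hDK p (hqK i p hp)
  obtain ⟨N, hlift, hN⟩ := (hev.and (eventually_gt_atTop 0)).exists
  have : Finite K := hKfin
  have : Finite {l : List (Fin m) // l.length ≤ N} := List.finite_length_le (Fin m) N
  obtain ⟨r, hrfin, hrr, hr⟩ := Φ.exists_retraction (R.label Φ D N) N
  have hrK : ∀ k ∈ K, r k = k := fun k hk =>
    Φ.eq_const_of_color_eq hN hk (R.color_eq_of_label_eq (hr k).lab_eq)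
  set M : Set (BAtom U B C) := BAtom.map r '' R.skeleton Φ D with hM
  have hDM : D ⊆ M := fun A hA =>
    ⟨A, .inl hA, BAtom.map_eq_self fun a ha => hrK a (hDK A hA a ha)⟩
  have hMfin : M.Finite := by
    refine (hD.union (Set.finite_iUnion fun i : Fin m =>
      Set.Finite.image2 (fun e f => R.atom i e f) hrfin hrfin)).subset ?_
    rintro _ ⟨A, hA | ⟨i, c, -, rfl⟩, rfl⟩
    · rw [BAtom.map_eq_self fun a ha => hrK a (hDK A hA a ha)]
      exact .inl hA
    · rw [R.map_atom]
      exact .inr (Set.mem_iUnion.2 ⟨i, _, ⟨c, rfl⟩, _, ⟨_, rfl⟩, rfl⟩)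
  -- Datalog rules create no elements, so the closure still lives on the fixed points of `r`.
  have hMr : ∀ A ∈ DatalogClosure T M, ∀ a ∈ A.args, r a = a := by
    intro A hA
    refine DatalogClosure.args_mem (Y := {a | r a = a}) (fun c hc => hrK c (hTK hc)) ?_ hA
    rintro _ ⟨A, -, rfl⟩ a ha
    obtain ⟨a, -, rfl⟩ := BAtom.mem_args_map.1 ha
    exact hrr a
  refine ⟨DatalogClosure T M, DatalogClosure.finite hMfin,
    hDM.trans DatalogClosure.subset_closed, ?_, ?_⟩
  · intro ρ hρ s hs
    by_cases hd : IsDatalogHead (varsOf ρ.body) ρ.head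
    · exact ⟨s, fun _ _ => rfl, .rule ρ hρ hd s hs⟩
    obtain ⟨i, rfl⟩ := R.complete ρ hρ hd
    -- The rewriting trades a match that uses datalog consequences for one in `M` alone.
    obtain ⟨p, hp, hpM⟩ := (hq' i M hMfin fun _ => (R.frontier i).eval id s).1
      (DatalogClosure.certain ⟨s, hs, fun _ => rfl⟩)
    obtain ⟨a', ha', hlab⟩ := hlift i p hp r hr _ hpM
    have hfires : R.Fires Φ D i (a' 0) := by
      have := holds_of_rewriting_holds (hq' i) (R.skeleton_subset Φ D)
        (R.skolemChase_satisfied Φ D) hp ha'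
      rwa [show a' = fun _ => a' 0 from funext fun j => by rw [Subsingleton.elim j 0]] at this
    rw [R.fires_of_label_eq (hlab 0)] at hfires
    have hfix : (R.frontier i).eval id s ∈ {a | r a = a} :=
      (R.frontier_varIn i).eval_mem (fun c hc => hrK c ((R.frontier_const i c hc).elim
        (fun h => h ▸ hc₀) fun h => hTK h)) fun A hA => hMr _ (hs A hA)
    -- The frontier element is its own representative and the rule fires at it in the chase, so the
    -- image of its child under `r` is a witness.
    refine R.headHolds_iff.2 ⟨r (Φ.nul i ((R.frontier i).eval id s)), .base _ ⟨_, .inr ⟨i, _,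
      hfires, rfl⟩, ?_⟩⟩
    rw [R.map_atom, show r _ = _ from hfix]
  · intro A hA hAF
    cases hA with
    | base A hA =>
      obtain ⟨A, hA, rfl⟩ := hA
      have : Nonempty (ChaseElem U B C) := ⟨.const c₀⟩
      obtain ⟨h, hh⟩ := R.exists_hom (Φ := Φ) hc₀ hTK hDK (J := chase T D) (ι := ChaseElem.const)
        (fun A hA => Set.mem_iUnion.2 ⟨0, A, hA, rfl⟩) (chase_satisfied T D)
      exact hchase _ (hh A (R.skeleton_subset Φ D hA))
        (BAtom.hasPred_map.2 (BAtom.hasPred_map.1 hAF))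
    -- The only rule with `F` in its head has an existential variable there, so it is not a datalog
    -- rule.
    | rule ρ hρ hd s h =>
      obtain ⟨σ, -, ⟨y, -, z, hz, hσ⟩, -, hother⟩ := hF
      by_cases hρσ : ρ = σ
      · subst hρσ
        rw [hσ] at hd
        exact hz (hd (.var z) (by simp [BAtom.args]) z rfl)
      · exact hother ρ hρ hρσ (.inl (BAtom.hasPred_map.1 hAF))
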